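/- For a finite set $P\subset\mathbb R^d$ and $1\le k\le |P|$, let $$\mathrm d_{P,k}(x)=\Big(\tfrac1k\min_{T\subseteq P,\ |T|=k}\ \sum_{p\in T}\|x-p\|^2\Big)^{1/2}\qquad(x\in\mathbb R^d)$$ be the $k$-distance to $P$. For a nonempty finite set of sites $Q\subset\mathbb R^d$ and weights $w_q\ge 0$ $(q\in Q)$, let $\phi_Q^w(x)=\big(\min_{q\in Q}(\|x-q\|^2+w_q)\big)^{1/2}$. The $\varepsilon$-complexity of a function $\phi:\mathbb R^d\to\mathbb R$ is $$\mathcal N(\phi,\varepsilon)=\min\Big\{|Q|\ :\ \sup_{x\in\mathbb R^d}|\phi(x)-\phi_Q^w(x)|\le\varepsilon \text{ for some weights } w_q\ge0\Big\}.$$ **Corollary.** There exist an absolute constant $C_1>0$ and a sequence $(S_d)_{d\ge 2}$ of finite point sets on the unit spheres $\mathcal S^{d-1}\subset\mathbb R^d$, where $|S_d|=2\left\lceil \tfrac12 d^2(\log d+C_1)\right\rceil$ (that is, $d^2(\log d+C_1)$ rounded up to an even integer), such that for every $d\ge 2$ $$\mathcal N\Big(\mathrm d_{S_d,\frac12|S_d|},\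 \frac{\sqrt{2/\pi}}{d}\Big)\ \ge\ 2\sqrt d\,\Big(\frac d{64}\Big)^{\frac{d-1}4}.$$ -/

import Mathlib

noncomputable section

namespace HalvingDistance

/-- The `k`-distance to a finite point set `P`:
`x ↦ ((1 / k) * min ∑ p ∈ T, ‖x - p‖ ^ 2) ^ (1 / 2)`, the minimum being over the sets `T` of `k`
distinct points of `P`. For `1 ≤ k ≤ |P|` the index set is finite and nonempty, so the infimum
is a minimum. -/
def kDist {d : ℕ} (P : Finset (EuclideanSpace ℝ (Fin d))) (k : ℕ)
    (x : EuclideanSpace ℝ (Fin d)) : ℝ :=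
  Real.sqrt ((1 / (k : ℝ)) *
    ⨅ T : {T : Finset (EuclideanSpace ℝ (Fin d)) // T ∈ P.powersetCard k},
      ∑ p ∈ T.1, ‖x - p‖ ^ 2)

/-- The distance-like function with finite set of sites `Q` and weights `w`:
`x ↦ (min_{q ∈ Q} (‖x - q‖ ^ 2 + w q)) ^ (1 / 2)`. It is used for nonempty `Q` and weights that
are nonnegative on `Q`; then the infimum is a minimum. -/
def distLike {d : ℕ} (Q : Finset (EuclideanSpace ℝ (Fin d)))
    (w : EuclideanSpace ℝ (Fin d) → ℝ) (x : EuclideanSpace ℝ (Fin d)) : ℝ :=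
  Real.sqrt (⨅ q : {q : EuclideanSpace ℝ (Fin d) // q ∈ Q}, (‖x - q.1‖ ^ 2 + w q.1))

/-- `IsApprox φ ε n`: some distance-like function with exactly `n` sites and nonnegative weights
is at uniform distance at most `ε` from `φ` on the whole space. -/
def IsApprox {d : ℕ} (φ : EuclideanSpace ℝ (Fin d) → ℝ) (ε : ℝ) (n : ℕ) : Prop :=
  ∃ (Q : Finset (EuclideanSpace ℝ (Fin d))) (w : EuclideanSpace ℝ (Fin d) → ℝ),
    Q.Nonempty ∧ (∀ q ∈ Q, 0 ≤ w q) ∧ Q.card = n ∧ ∀ x, |φ x - distLike Q w x| ≤ ε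

/-- The `ε`-complexity of `φ`: the least number of sites of a distance-like function at uniform
distance at most `ε` from `φ`. -/
def complexity {d : ℕ} (φ : EuclideanSpace ℝ (Fin d) → ℝ) (ε : ℝ) : ℕ :=
  sInf {n : ℕ | IsApprox φ ε n}

end HalvingDistance

end

open MeasureTheory ProbabilityTheory Set
open scoped InnerProductSpace

/-! For an antipodal set {± a i} of 2m unit vectors, m nearest points to x are found by taking from
each pair the point on the side of x. So the squared halving distance is ‖x‖² + 1 - 2h(x), where
h(x), the mean of the |⟪a i, x⟫|, is the support function of a zonotope (`kDist_symmSet`). Expanding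
square roots at infinity along rays shows that the sites of an ε-approximation have a support
function within ε of h on the unit sphere (`support_close`).

If h is nearly a constant r there, the hull of the sites lies between balls of radii r(1 - η) and
r(1 + η), and a polytope that close to a ball has many vertices: balls centred at multiples of the
sites cover an annulus, and volumes are compared (`one_sub_pow_le_card_mul`). Since ε = √(2/π)/d and
r ≥ √(2/π)/√d, η can be of order 1/√d; the covering balls then have squared radius of order 1/√d,
whence the exponent of order d/4.

Suitable a i are found at random. For a uniform sample, symmetrization and contraction bound the
expected uniform deviation of ∑ |⟪a i, u⟫| from m r by O(√m), with no dimensional factor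
(`integral_deviation_le`). Thus m of order d² brings h within ε/10 of r; the logarithm in the sample
size only enlarges m. The bound on r comes from pairing with a Gaussian vector
(`exists_sphereLaw_const`). -/

namespace HalvingDistance

/-! ### Rademacher averages and contraction -/

/-- A sum over sign patterns of length `m + 1` splits off the first sign. -/
theorem sum_signs_succ {M : Type*} [AddCommMonoid M] (m : ℕ) (f : (Fin (m + 1) → ℤˣ) → M) :
    ∑ e, f e = ∑ e : Fin m → ℤˣ, (f (Fin.cons 1 e) + f (Fin.cons (-1) e)) := by
  rw [← (Fin.consEquiv (fun _ : Fin (m + 1) => ℤˣ)).sum_comp, Fintype.sum_prod_type,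
    UnitsInt.univ, Finset.sum_pair (by decide), ← Finset.sum_add_distrib]
  rfl

/-- Talagrand's contraction principle for the absolute value, in a form without suprema. -/
theorem exists_contraction {T : Type*} : ∀ (m : ℕ) (t : Fin m → T → ℝ) (c : T → ℝ)
    (u : (Fin m → ℤˣ) → T), ∃ v : (Fin m → ℤˣ) → T,
      ∑ e, (c (u e) + ∑ i, ((e i : ℤ) : ℝ) * |t i (u e)|) ≤
        ∑ e, (c (v e) + ∑ i, ((e i : ℤ) : ℝ) * t i (v e)) := by
  intro m
  induction m with
  | zero => intro t c u; exact ⟨u, by simp⟩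
  | succ m ih =>
    intro t c u
    obtain ⟨p, hp⟩ := ih (fun i => t i.succ) (fun x => c x + |t 0 x|) (fun e => u (Fin.cons 1 e))
    obtain ⟨q, hq⟩ := ih (fun i => t i.succ) (fun x => c x - |t 0 x|)
      (fun e => u (Fin.cons (-1) e))
    -- For a fixed tail of signs, |s| - |t| ≤ |s - t|: the absolute values at the two points can be
    -- dropped after swapping the points if necessary.
    have key : ∀ e : Fin m → ℤˣ, ∃ z : T × T,
        (c (p e) + |t 0 (p e)| + ∑ i, ((e i : ℤ) : ℝ) * t i.succ (p e)) +
          (c (q e) - |t 0 (q e)| + ∑ i, ((e i : ℤ) : ℝ) * t i.succ (q e)) ≤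
        (c z.1 + t 0 z.1 + ∑ i, ((e i : ℤ) : ℝ) * t i.succ z.1) +
          (c z.2 - t 0 z.2 + ∑ i, ((e i : ℤ) : ℝ) * t i.succ z.2) := by
      intro e
      have h := abs_sub_abs_le_abs_sub (t 0 (p e)) (t 0 (q e))
      rcases le_total (t 0 (q e)) (t 0 (p e)) with h' | h'
      · rw [abs_of_nonneg (sub_nonneg.2 h')] at h
        exact ⟨(p e, q e), by simp only; linarith⟩
      · rw [abs_of_nonpos (sub_nonpos.2 h')] at h
        exact ⟨(q e, p e), by simp only; linarith⟩
    choose z hz using key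
    refine ⟨fun e => if e 0 = 1 then (z (Fin.tail e)).1 else (z (Fin.tail e)).2, ?_⟩
    rw [sum_signs_succ, sum_signs_succ]
    have hne : (-1 : ℤˣ) ≠ 1 := by decide
    simp only [Fin.sum_univ_succ, Fin.cons_zero, Fin.cons_succ, Fin.tail_cons, if_true, hne,
      if_false, Units.val_one, Units.val_neg, Int.cast_one, Int.cast_neg, one_mul, neg_mul]
    have h2 := Finset.sum_le_sum (s := Finset.univ) fun e _ => hz e
    rw [Finset.sum_add_distrib] at h2 ⊢
    refine le_trans (add_le_add ?_ ?_) (h2.trans (le_of_eq ?_))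
    · refine le_trans (le_of_eq ?_) hp
      exact Finset.sum_congr rfl fun e _ => by ring
    · refine le_trans (le_of_eq ?_) hq
      exact Finset.sum_congr rfl fun e _ => by ring
    · exact Finset.sum_congr rfl fun e _ => by ring

section Inner

variable {E : Type*} [NormedAddCommGroup E] [InnerProductSpace ℝ E]

/-- Each sign is averaged out by the parallelogram law; the offset x makes the induction go through.
-/
theorem sum_signs_norm_sq : ∀ (m : ℕ) (a : Fin m → E) (x : E),
    ∑ e : Fin m → ℤˣ, ‖x + ∑ i, ((e i : ℤ) : ℝ) • a i‖ ^ 2 =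
      2 ^ m * (‖x‖ ^ 2 + ∑ i, ‖a i‖ ^ 2) := by
  intro m
  induction m with
  | zero => intro a x; simp
  | succ m ih =>
    intro a x
    rw [sum_signs_succ, Finset.sum_add_distrib]
    simp only [Fin.sum_univ_succ, Fin.cons_zero, Fin.cons_succ, Units.val_one, Units.val_neg,
      Int.cast_one, Int.cast_neg, one_smul, neg_smul, ← add_assoc]
    rw [ih (fun i => a i.succ) (x + a 0), ih (fun i => a i.succ) (x + -a 0)]
    have := parallelogram_law_with_norm ℝ x (a 0)
    rw [← sub_eq_add_neg, pow_succ]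
    linear_combination (2 : ℝ) ^ m * this

/-- The average norm of a signed sum of `m` unit vectors is at most `√m`. -/
theorem sum_signs_norm_le (m : ℕ) (a : Fin m → E) (ha : ∀ i, ‖a i‖ = 1) :
    ∑ e : Fin m → ℤˣ, ‖∑ i, ((e i : ℤ) : ℝ) • a i‖ ≤ 2 ^ m * √m := by
  have h := sum_signs_norm_sq m a 0
  simp only [zero_add, ha, norm_zero] at h
  -- Cauchy–Schwarz over the 2^m patterns turns the mean square into a bound on the mean.
  have h2 := sq_sum_le_card_mul_sum_sq (s := Finset.univ)
    (f := fun e : Fin m → ℤˣ => ‖∑ i, ((e i : ℤ) : ℝ) • a i‖)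
  rw [h] at h2
  refine le_of_sq_le_sq (h2.trans (le_of_eq ?_)) (by positivity)
  rw [mul_pow, Real.sq_sqrt (by positivity)]
  simp [Fintype.card_pi]
  ring

/-- Contraction and the norm bound combined: a signed sum of the functions `|⟪a i, ·⟫|`, at a
point of the unit ball chosen depending on the signs, is at most `√m` on average. -/
theorem sum_signs_abs_inner_le (m : ℕ) (a : Fin m → E) (ha : ∀ i, ‖a i‖ = 1)
    (u : (Fin m → ℤˣ) → E) (hu : ∀ e, ‖u e‖ ≤ 1) :
    ∑ e, ∑ i, ((e i : ℤ) : ℝ) * |⟪a i, u e⟫_ℝ| ≤ 2 ^ m * √m := by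
  obtain ⟨v, hv⟩ := exists_contraction (T := {x : E // ‖x‖ ≤ 1}) m (fun i x => ⟪a i, x.1⟫_ℝ)
    (fun _ => 0) (fun e => ⟨u e, hu e⟩)
  simp only [zero_add] at hv
  refine hv.trans (le_trans (Finset.sum_le_sum fun e _ => ?_) (sum_signs_norm_le m a ha))
  have : ∑ i, ((e i : ℤ) : ℝ) * ⟪a i, (v e).1⟫_ℝ = ⟪∑ i, ((e i : ℤ) : ℝ) • a i, (v e).1⟫_ℝ := by
    simp [sum_inner, real_inner_smul_left]
  rw [this]
  refine (real_inner_le_norm _ _).trans ?_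
  exact mul_le_of_le_one_right (norm_nonneg _) (v e).2

/-- The same for differences. -/
theorem sum_signs_abs_inner_sub_le (m : ℕ) (a b : Fin m → E) (ha : ∀ i, ‖a i‖ = 1)
    (hb : ∀ i, ‖b i‖ = 1) (u : (Fin m → ℤˣ) → E) (hu : ∀ e, ‖u e‖ ≤ 1) :
    ∑ e, ∑ i, ((e i : ℤ) : ℝ) * (|⟪a i, u e⟫_ℝ| - |⟪b i, u e⟫_ℝ|) ≤ 2 ^ m * (2 * √m) := by
  have h1 := sum_signs_abs_inner_le m a ha u hu
  -- Reversing all signs absorbs the minus sign in front of the second family.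
  have h2 := sum_signs_abs_inner_le m b hb (fun e => u (-e)) (fun e => hu _)
  rw [← Equiv.sum_comp (Equiv.neg (Fin m → ℤˣ))] at h2
  simp only [Equiv.neg_apply, neg_neg, Pi.neg_apply, Units.val_neg, Int.cast_neg, neg_mul,
    Finset.sum_neg_distrib] at h2
  simp only [mul_sub, Finset.sum_sub_distrib]
  linarith

/-! ### Symmetrization of suprema over the unit ball -/

/-- The supremum of a function over the closed unit ball. -/
noncomputable def ballSup (f : E → ℝ) : ℝ := sSup (f '' Metric.closedBall 0 1)

variable [FiniteDimensional ℝ E]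

theorem exists_eq_ballSup {f : E → ℝ} (hf : Continuous f) : ∃ u, ‖u‖ ≤ 1 ∧ ballSup f = f u := by
  obtain ⟨u, hu, h⟩ := (isCompact_closedBall (0 : E) 1).exists_sSup_image_eq
    ⟨0, by simp⟩ hf.continuousOn
  exact ⟨u, by simpa using hu, h⟩

theorem le_ballSup {f : E → ℝ} (hf : Continuous f) {u : E} (hu : ‖u‖ ≤ 1) : f u ≤ ballSup f :=
  le_csSup ((isCompact_closedBall (0 : E) 1).image hf).bddAbove
    ⟨u, by simpa using hu, rfl⟩

theorem continuous_ballSup {X : Type*} [TopologicalSpace X] {f : X → E → ℝ}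
    (hf : Continuous (Function.uncurry f)) : Continuous fun x => ballSup (f x) :=
  (isCompact_closedBall (0 : E) 1).continuous_sSup hf

/-- The supremum over the unit ball of a signed sum of the differences of the functions
`|⟪·, u⟫|` at pairs of points. -/
noncomputable def signedSup {m : ℕ} (e : Fin m → ℤˣ) (w : Fin m → E × E) : ℝ :=
  ballSup fun u => ∑ i, ((e i : ℤ) : ℝ) * (|⟪(w i).1, u⟫_ℝ| - |⟪(w i).2, u⟫_ℝ|)

theorem continuous_signedSup {m : ℕ} (e : Fin m → ℤˣ) :
    Continuous (signedSup (E := E) e) :=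
  continuous_ballSup (by fun_prop)

theorem abs_signedSup_le {m : ℕ} (e : Fin m → ℤˣ) (w : Fin m → E × E)
    (h : ∀ i, ‖(w i).1‖ = 1 ∧ ‖(w i).2‖ = 1) : |signedSup e w| ≤ m := by
  obtain ⟨u, hu, h'⟩ := exists_eq_ballSup
    (f := fun u : E => ∑ i, ((e i : ℤ) : ℝ) * (|⟪(w i).1, u⟫_ℝ| - |⟪(w i).2, u⟫_ℝ|)) (by fun_prop)
  rw [signedSup, h']
  refine (Finset.abs_sum_le_sum_abs _ _).trans ?_
  refine (Finset.sum_le_card_nsmul _ _ 1 fun i _ => ?_).trans (by simp)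
  have he : |((e i : ℤ) : ℝ)| = 1 := by
    rcases Int.units_eq_one_or (e i) with h | h <;> simp [h]
  rw [abs_mul, he, one_mul]
  have h1 := abs_real_inner_le_norm (w i).1 u
  have h2 := abs_real_inner_le_norm (w i).2 u
  rw [(h i).1, one_mul] at h1
  rw [(h i).2, one_mul] at h2
  rw [abs_le]
  constructor <;> linarith [abs_nonneg ⟪(w i).1, u⟫_ℝ, abs_nonneg ⟪(w i).2, u⟫_ℝ]

theorem ae_pi_of_ae {ι : Type*} [Fintype ι] {α : Type*} [MeasurableSpace α] (μ : Measure α)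
    [IsProbabilityMeasure μ] {p : α → Prop} (h : ∀ᵐ x ∂μ, p x) :
    ∀ᵐ w ∂(Measure.pi fun _ : ι => μ), ∀ i, p (w i) :=
  ae_all_iff.2 fun i => (measurePreserving_eval (fun _ : ι => μ) i).quasiMeasurePreserving.ae h

variable [MeasurableSpace E]

theorem ae_prod_norm {μ : Measure E} [IsProbabilityMeasure μ] (hμ : ∀ᵐ a ∂μ, ‖a‖ = 1) :
    ∀ᵐ w ∂(μ.prod μ), ‖w.1‖ = 1 ∧ ‖w.2‖ = 1 :=
  (measurePreserving_fst.quasiMeasurePreserving.ae hμ).and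
    (measurePreserving_snd.quasiMeasurePreserving.ae hμ)

variable [BorelSpace E]

theorem integrable_signedSup {m : ℕ} {μ : Measure E} [IsProbabilityMeasure μ]
    (hμ : ∀ᵐ a ∂μ, ‖a‖ = 1) (e : Fin m → ℤˣ) :
    Integrable (signedSup e) (Measure.pi fun _ : Fin m => μ.prod μ) := by
  refine Integrable.of_bound (continuous_signedSup e).aestronglyMeasurable m ?_
  filter_upwards [ae_pi_of_ae _ (ae_prod_norm hμ)] with w hw
  exact abs_signedSup_le e w hw

/-- Swapping the two members of the i-th pair preserves the product law and flips the i-th summand,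
so signs do not affect the mean. -/
theorem integral_signedSup_eq {m : ℕ} {μ : Measure E} [IsProbabilityMeasure μ]
    (e : Fin m → ℤˣ) :
    ∫ w, signedSup e w ∂(Measure.pi fun _ : Fin m => μ.prod μ) =
      ∫ w, signedSup 1 w ∂(Measure.pi fun _ : Fin m => μ.prod μ) := by
  have hmp : ∀ i : Fin m, MeasurePreserving (if e i = 1 then id else Prod.swap : E × E → E × E)
      (μ.prod μ) (μ.prod μ) := fun i => by
    split_ifs
    · exact MeasurePreserving.id _
    · exact Measure.measurePreserving_swap
  have h := measurePreserving_pi (fun _ : Fin m => μ.prod μ) (fun _ : Fin m => μ.prod μ) hmp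
  rw [← h.map_eq, integral_map h.measurable.aemeasurable
    (continuous_signedSup 1).aestronglyMeasurable, h.map_eq]
  refine integral_congr_ae (ae_of_all _ fun w => ?_)
  simp only [signedSup]
  congr 1
  funext u
  refine Finset.sum_congr rfl fun i _ => ?_
  rcases Int.units_eq_one_or (e i) with h | h <;> simp [h]

/-- The mean is the same for every pattern, hence equals its average over patterns, which is bounded
pointwise by contraction. -/
theorem integral_signedSup_le {m : ℕ} {μ : Measure E} [IsProbabilityMeasure μ]
    (hμ : ∀ᵐ a ∂μ, ‖a‖ = 1) (e : Fin m → ℤˣ) :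
    ∫ w, signedSup e w ∂(Measure.pi fun _ : Fin m => μ.prod μ) ≤ 2 * √m := by
  have h1 : ∫ w, ∑ e : Fin m → ℤˣ, signedSup e w ∂(Measure.pi fun _ : Fin m => μ.prod μ) ≤
      2 ^ m * (2 * √m) := by
    refine (integral_mono_ae (integrable_finsetSum _ fun e _ => integrable_signedSup hμ e)
      (integrable_const (2 ^ m * (2 * √m))) ?_).trans (by simp)
    filter_upwards [ae_pi_of_ae _ (ae_prod_norm hμ)] with w hw
    choose u hu hu' using fun e : Fin m → ℤˣ => exists_eq_ballSup
      (f := fun u : E => ∑ i, ((e i : ℤ) : ℝ) * (|⟪(w i).1, u⟫_ℝ| - |⟪(w i).2, u⟫_ℝ|))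
      (by fun_prop)
    simp only [signedSup, hu']
    exact sum_signs_abs_inner_sub_le m _ _ (fun i => (hw i).1) (fun i => (hw i).2) u hu
  rw [integral_finsetSum _ fun e _ => integrable_signedSup hμ e] at h1
  simp only [integral_signedSup_eq (μ := μ)] at h1
  rw [integral_signedSup_eq]
  simp only [Finset.sum_const, Finset.card_univ, Fintype.card_pi, nsmul_eq_mul] at h1
  simp only [Fintype.card_units_int, Finset.prod_const, Finset.card_univ, Fintype.card_fin] at h1
  push_cast at h1
  exact le_of_mul_le_mul_left h1 (by positivity)

end Inner

/-! ### Uniform deviation of a random sample -/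

section Inner

variable {E : Type*} [NormedAddCommGroup E] [InnerProductSpace ℝ E] [FiniteDimensional ℝ E]

/-- The supremum over the unit ball of the signed deviation of `∑ i, |⟪a i, u⟫|` from
`m * r * ‖u‖`. -/
noncomputable def deviation {m : ℕ} (r : ℝ) (s : ℤˣ) (a : Fin m → E) : ℝ :=
  ballSup fun u => ((s : ℤ) : ℝ) * (∑ i, |⟪a i, u⟫_ℝ| - m * (r * ‖u‖))

theorem continuous_deviation {m : ℕ} (r : ℝ) (s : ℤˣ) :
    Continuous (deviation (E := E) (m := m) r s) :=
  continuous_ballSup (by fun_prop)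

theorem deviation_nonneg {m : ℕ} (r : ℝ) (s : ℤˣ) (a : Fin m → E) : 0 ≤ deviation r s a := by
  refine le_trans (by simp) (le_ballSup
    (f := fun u => ((s : ℤ) : ℝ) * (∑ i, |⟪a i, u⟫_ℝ| - m * (r * ‖u‖))) (by fun_prop)
    (u := 0) (by simp))

theorem abs_le_deviation_add {m : ℕ} (r : ℝ) (a : Fin m → E) {u : E} (hu : ‖u‖ = 1) :
    |∑ i, |⟪a i, u⟫_ℝ| - m * r| ≤ deviation r 1 a + deviation r (-1) a := by
  have h := fun s : ℤˣ => le_ballSup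
    (f := fun u => ((s : ℤ) : ℝ) * (∑ i, |⟪a i, u⟫_ℝ| - m * (r * ‖u‖))) (by fun_prop) hu.le
  have h1 := h 1
  have h2 := h (-1)
  have h3 := deviation_nonneg r 1 a
  have h4 := deviation_nonneg r (-1) a
  simp only [hu, mul_one, Units.val_one, Units.val_neg, Int.cast_one, Int.cast_neg, one_mul,
    neg_mul] at h1 h2
  simp only [deviation, Units.val_one, Units.val_neg, Int.cast_one, Int.cast_neg, one_mul,
    neg_mul] at h3 h4 ⊢
  rw [abs_le]
  constructor <;> linarith

variable [MeasurableSpace E]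

variable {m : ℕ} {μ : Measure E} [IsProbabilityMeasure μ]

theorem measurePreserving_zip :
    MeasurePreserving (fun (p : (Fin m → E) × (Fin m → E)) i => (p.1 i, p.2 i))
      ((Measure.pi fun _ : Fin m => μ).prod (Measure.pi fun _ : Fin m => μ))
      (Measure.pi fun _ : Fin m => μ.prod μ) :=
  (measurePreserving_arrowProdEquivProdArrow E E (Fin m) (fun _ => μ) (fun _ => μ)).symm

variable [BorelSpace E]

theorem integrable_abs_inner (hμ : ∀ᵐ a ∂μ, ‖a‖ = 1)
    (u : E) : Integrable (fun a => |⟪a, u⟫_ℝ|) μ := by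
  refine Integrable.of_bound (by fun_prop) ‖u‖ ?_
  filter_upwards [hμ] with a ha
  simpa [ha] using abs_real_inner_le_norm a u

theorem integrable_signedSup_zip (hμ : ∀ᵐ a ∂μ, ‖a‖ = 1) (e : Fin m → ℤˣ) :
    Integrable (fun p : (Fin m → E) × (Fin m → E) => signedSup e fun i => (p.1 i, p.2 i))
      ((Measure.pi fun _ : Fin m => μ).prod (Measure.pi fun _ : Fin m => μ)) :=
  measurePreserving_zip.integrable_comp_of_integrable (integrable_signedSup hμ e)

/-- Ghost sample: at a maximizing u, m r ‖u‖ is the expectation of ∑ |⟪b i, u⟫| over an independent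
copy b, and a supremum of expectations is at most the expectation of the supremum. -/
theorem deviation_le_integral (hμ : ∀ᵐ a ∂μ, ‖a‖ = 1) {r : ℝ}
    (hr : ∀ u : E, ∫ a, |⟪a, u⟫_ℝ| ∂μ = r * ‖u‖) (s : ℤˣ) (a : Fin m → E)
    (ha : Integrable (fun b : Fin m → E => signedSup (fun _ => s) fun i => (a i, b i))
      (Measure.pi fun _ : Fin m => μ)) :
    deviation r s a ≤
      ∫ b, signedSup (fun _ => s) (fun i => (a i, b i)) ∂(Measure.pi fun _ : Fin m => μ) := by
  obtain ⟨u, hu, h⟩ := exists_eq_ballSup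
    (f := fun u => ((s : ℤ) : ℝ) * (∑ i, |⟪a i, u⟫_ℝ| - m * (r * ‖u‖))) (by fun_prop)
  have hint : ∀ i : Fin m, Integrable (fun b : Fin m → E => |⟪b i, u⟫_ℝ|)
      (Measure.pi fun _ : Fin m => μ) := fun i =>
    (measurePreserving_eval (fun _ : Fin m => μ) i).integrable_comp_of_integrable
      (integrable_abs_inner hμ u)
  have hval : ∀ i : Fin m, ∫ b : Fin m → E, |⟪b i, u⟫_ℝ| ∂(Measure.pi fun _ : Fin m => μ) =
      r * ‖u‖ := fun i => by
    rw [← hr u, ← (measurePreserving_eval (fun _ : Fin m => μ) i).map_eq,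
      integral_map (measurable_pi_apply i).aemeasurable (by fun_prop)]
    simp [(measurePreserving_eval (fun _ : Fin m => μ) i).map_eq]
  have hint2 : ∀ i ∈ (Finset.univ : Finset (Fin m)), Integrable (fun b : Fin m → E =>
      ((s : ℤ) : ℝ) * (|⟪a i, u⟫_ℝ| - |⟪b i, u⟫_ℝ|)) (Measure.pi fun _ : Fin m => μ) := fun i _ =>
    ((integrable_const _).sub (hint i)).const_mul _
  have hsum : ∫ b : Fin m → E, ∑ i, ((s : ℤ) : ℝ) * (|⟪a i, u⟫_ℝ| - |⟪b i, u⟫_ℝ|)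
      ∂(Measure.pi fun _ : Fin m => μ) = deviation r s a := by
    rw [deviation, h, integral_finsetSum _ hint2]
    simp only [integral_const_mul, integral_sub (integrable_const _) (hint _), hval]
    simp [← Finset.mul_sum]
  rw [← hsum]
  refine integral_mono (integrable_finsetSum _ hint2) ha fun b => ?_
  exact le_ballSup (f := fun u : E => ∑ i, ((s : ℤ) : ℝ) * (|⟪a i, u⟫_ℝ| - |⟪b i, u⟫_ℝ|))
    (by fun_prop) hu

theorem integrable_deviation (hμ : ∀ᵐ a ∂μ, ‖a‖ = 1) (r : ℝ) (s : ℤˣ) :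
    Integrable (deviation (m := m) r s) (Measure.pi fun _ : Fin m => μ) := by
  refine Integrable.of_bound (continuous_deviation r s).aestronglyMeasurable (m + m * |r|) ?_
  filter_upwards [ae_pi_of_ae _ hμ] with a ha
  obtain ⟨u, hu, h⟩ := exists_eq_ballSup
    (f := fun u => ((s : ℤ) : ℝ) * (∑ i, |⟪a i, u⟫_ℝ| - m * (r * ‖u‖))) (by fun_prop)
  have he : |((s : ℤ) : ℝ)| = 1 := by rcases Int.units_eq_one_or s with h | h <;> simp [h]
  rw [deviation, h, Real.norm_eq_abs, abs_mul, he, one_mul]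
  refine (abs_sub _ _).trans (add_le_add ?_ ?_)
  · refine (Finset.abs_sum_le_sum_abs _ _).trans ?_
    refine (Finset.sum_le_card_nsmul _ _ 1 fun i _ => ?_).trans (by simp)
    rw [abs_abs]
    refine (abs_real_inner_le_norm _ _).trans ?_
    rwa [ha i, one_mul]
  · rw [abs_mul, abs_mul, Nat.abs_cast, abs_norm]
    gcongr
    exact mul_le_of_le_one_right (abs_nonneg r) hu

theorem integral_deviation_le (hμ : ∀ᵐ a ∂μ, ‖a‖ = 1) {r : ℝ}
    (hr : ∀ u : E, ∫ a, |⟪a, u⟫_ℝ| ∂μ = r * ‖u‖) (s : ℤˣ) :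
    ∫ a, deviation r s a ∂(Measure.pi fun _ : Fin m => μ) ≤ 2 * √m := by
  have hint := integrable_signedSup_zip (m := m) hμ (fun _ => s)
  refine le_trans ?_ (integral_signedSup_le hμ (m := m) (fun _ => s))
  have hz := measurePreserving_zip (m := m) (μ := μ)
  rw [← hz.map_eq, integral_map hz.measurable.aemeasurable
    (continuous_signedSup _).aestronglyMeasurable, integral_prod _ hint]
  refine integral_mono_ae (integrable_deviation hμ r s) hint.integral_prod_left ?_
  filter_upwards [hint.prod_right_ae] with a ha
  exact deviation_le_integral hμ hr s a ha

/-- By independence and Fubini, since an atomless law does not charge the two points ± a i. This is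
what gives the symmetric set exactly 2m points. -/
theorem pi_null_eq_or_eq_neg [NullSingletonClass μ] {i j : Fin m} (hij : i ≠ j) :
    ∀ᵐ a ∂(Measure.pi fun _ : Fin m => μ), a i ≠ a j ∧ a i ≠ -a j := by
  have hind : IndepFun (fun a : Fin m → E => a i) (fun a : Fin m → E => a j)
      (Measure.pi fun _ : Fin m => μ) :=
    (iIndepFun_pi (μ := fun _ : Fin m => μ) (X := fun _ => id)
      (fun _ => aemeasurable_id)).indepFun hij
  have hmap := (indepFun_iff_map_prod_eq_prod_map_map (measurable_pi_apply i).aemeasurable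
    (measurable_pi_apply j).aemeasurable).1 hind
  rw [(measurePreserving_eval (fun _ : Fin m => μ) i).map_eq,
    (measurePreserving_eval (fun _ : Fin m => μ) j).map_eq] at hmap
  have hae : ∀ᵐ p ∂(μ.prod μ), p.1 ≠ p.2 ∧ p.1 ≠ -p.2 := by
    have hmeas : MeasurableSet {p : E × E | p.1 ≠ p.2 ∧ p.1 ≠ -p.2} :=
      ((isOpen_ne_fun continuous_fst continuous_snd).inter
        (isOpen_ne_fun continuous_fst continuous_snd.neg)).measurableSet
    rw [Measure.ae_prod_iff_ae_ae hmeas]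
    refine ae_of_all _ fun x => ?_
    have h1 : ∀ᵐ y ∂μ, y ≠ x := by simp [ae_iff]
    have h2 : ∀ᵐ y ∂μ, y ≠ -x := by simp [ae_iff]
    filter_upwards [h1, h2] with y hy1 hy2
    exact ⟨hy1.symm, fun h => hy2 (by rw [h, neg_neg])⟩
  rw [← hmap] at hae
  exact ae_of_ae_map (by fun_prop) hae

/-- An atomless law on the unit sphere with rotation-invariant first absolute moments has a sample
of size `m` whose zonotope is uniformly close to a ball. -/
theorem exists_sample [NullSingletonClass μ] (hμ : ∀ᵐ a ∂μ, ‖a‖ = 1) {r : ℝ}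
    (hr : ∀ u : E, ∫ a, |⟪a, u⟫_ℝ| ∂μ = r * ‖u‖) (m : ℕ) :
    ∃ a : Fin m → E, (∀ i, ‖a i‖ = 1) ∧ (∀ i j, i ≠ j → a i ≠ a j ∧ a i ≠ -a j) ∧
      ∀ u : E, ‖u‖ = 1 → |∑ i, |⟪a i, u⟫_ℝ| - m * r| ≤ 4 * √m := by
  have hae : ∀ᵐ a ∂(Measure.pi fun _ : Fin m => μ), (∀ i, ‖a i‖ = 1) ∧
      ∀ i j, i ≠ j → a i ≠ a j ∧ a i ≠ -a j :=
    (ae_pi_of_ae _ hμ).and (ae_all_iff.2 fun i => ae_all_iff.2 fun j =>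
      ae_all_iff.2 fun hij => pi_null_eq_or_eq_neg hij)
  -- Outside the null set some sample does no worse than the mean of the sum of both one-sided
  -- deviations.
  obtain ⟨a, ha, h⟩ := exists_notMem_null_le_integral
    ((integrable_deviation (m := m) hμ r 1).add (integrable_deviation (m := m) hμ r (-1)))
    (ae_iff.1 hae)
  rw [mem_ofPred_eq, not_not] at ha
  refine ⟨a, ha.1, ha.2, fun u hu => (abs_le_deviation_add r a hu).trans (h.trans ?_)⟩
  simp only [Pi.add_apply]
  rw [integral_add (integrable_deviation hμ r 1) (integrable_deviation hμ r (-1))]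
  linarith [integral_deviation_le (m := m) hμ hr 1, integral_deviation_le (m := m) hμ hr (-1)]

end Inner

/-! ### Gaussian vectors and the uniform law on the sphere -/

theorem integral_abs_gaussianReal : ∫ x, |x| ∂(gaussianReal 0 1) = √(2 / Real.pi) := by
  rw [integral_gaussianReal_eq_integral_smul one_ne_zero]
  have h1 : ∀ x : ℝ, gaussianPDFReal 0 1 x • |x| =
      (√(2 * Real.pi))⁻¹ * (|x| ^ (1 : ℝ) * Real.exp (-(1 / 2) * |x| ^ (2 : ℝ))) := by
    intro x
    rw [gaussianPDFReal_def, Real.rpow_one, Real.rpow_two, sq_abs, smul_eq_mul]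
    simp only [NNReal.coe_one, mul_one, sub_zero]
    rw [show -x ^ 2 / 2 = -(1 / 2) * x ^ 2 by ring]
    ring
  simp only [h1, integral_const_mul]
  rw [integral_comp_abs (f := fun x => x ^ (1 : ℝ) * Real.exp (-(1 / 2) * x ^ (2 : ℝ))),
    integral_rpow_mul_exp_neg_mul_rpow (by norm_num) (by norm_num) (by norm_num)]
  norm_num
  rw [show Real.sqrt 2 / √Real.pi = 2 / (√2 * √Real.pi) by
    rw [div_eq_div_iff (by positivity) (by positivity)]
    linear_combination √Real.pi * (Real.mul_self_sqrt (show (0 : ℝ) ≤ 2 by norm_num))]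
  ring

section Sphere

variable {E : Type*} [NormedAddCommGroup E] [InnerProductSpace ℝ E]

theorem norm_smul_normalize (g : E) : ‖g‖ • (‖g‖⁻¹ • g) = g := by
  rcases eq_or_ne g 0 with rfl | h
  · simp
  · rw [smul_smul, mul_inv_cancel₀ (norm_ne_zero_iff.2 h), one_smul]

theorem exists_unit_inner_eq_zero (hd : 2 ≤ Module.finrank ℝ E) (x : E) :
    ∃ w : E, ‖w‖ = 1 ∧ ⟪x, w⟫_ℝ = 0 := by
  have hne : (ℝ ∙ x)ᗮ ≠ ⊥ := by
    intro h
    rw [Submodule.orthogonal_eq_bot_iff] at h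
    have h1 := finrank_span_le_card (R := ℝ) ({x} : Set E)
    rw [h, finrank_top] at h1
    simp at h1
    omega
  obtain ⟨w, hw, hw0⟩ := Submodule.exists_mem_ne_zero_of_ne_bot hne
  rw [Submodule.mem_orthogonal_singleton_iff_inner_right] at hw
  refine ⟨‖w‖⁻¹ • w, ?_, by rw [real_inner_smul_right, hw, mul_zero]⟩
  rw [norm_smul, norm_inv, norm_norm, inv_mul_cancel₀ (norm_ne_zero_iff.2 hw0)]

variable [FiniteDimensional ℝ E] [MeasurableSpace E] [BorelSpace E]

theorem stdGaussian_map_inner {w : E} (hw : ‖w‖ = 1) :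
    (stdGaussian E).map (fun g => ⟪w, g⟫_ℝ) = gaussianReal 0 1 := by
  have h := IsGaussian.map_eq_gaussianReal (μ := stdGaussian E) (innerSL ℝ w)
  rw [integral_strongDual_stdGaussian, variance_dual_stdGaussian, innerSL_apply_norm, hw] at h
  simpa using h

theorem ae_stdGaussian_inner_ne_zero {w : E} (hw : ‖w‖ = 1) :
    ∀ᵐ g ∂(stdGaussian E), ⟪w, g⟫_ℝ ≠ 0 := by
  have := nullSingletonClass_gaussianReal (μ := 0) (v := 1) one_ne_zero
  have h : ∀ᵐ x ∂(gaussianReal 0 1), x ≠ 0 := by simp [ae_iff]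
  rw [← stdGaussian_map_inner hw] at h
  exact ae_of_ae_map (f := fun g => ⟪w, g⟫_ℝ) (by fun_prop) h

theorem integral_abs_inner_stdGaussian {w : E} (hw : ‖w‖ = 1) :
    ∫ g, |⟪w, g⟫_ℝ| ∂(stdGaussian E) = √(2 / Real.pi) := by
  rw [← integral_abs_gaussianReal, ← stdGaussian_map_inner hw,
    integral_map (by fun_prop) (by fun_prop)]

theorem integrable_norm_sq_stdGaussian : Integrable (fun g : E => ‖g‖ ^ 2) (stdGaussian E) :=
  (IsGaussian.memLp_two_id (μ := stdGaussian E)).integrable_norm_pow two_ne_zero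

theorem integral_norm_sq_stdGaussian :
    ∫ g, ‖g‖ ^ 2 ∂(stdGaussian E) = Module.finrank ℝ E := by
  have h1 : ∀ i, ∫ g, ⟪stdOrthonormalBasis ℝ E i, g⟫_ℝ ^ 2 ∂(stdGaussian E) = 1 := by
    intro i
    have hw : ‖stdOrthonormalBasis ℝ E i‖ = 1 := (stdOrthonormalBasis ℝ E).norm_eq_one i
    have h := variance_dual_stdGaussian (innerSL ℝ (stdOrthonormalBasis ℝ E i))
    rw [variance_eq_integral (by fun_prop), integral_strongDual_stdGaussian, innerSL_apply_norm,
      hw] at h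
    simpa using h
  have h2 : ∀ g : E, ‖g‖ ^ 2 = ∑ i, ⟪stdOrthonormalBasis ℝ E i, g⟫_ℝ ^ 2 := by
    intro g
    rw [← (stdOrthonormalBasis ℝ E).sum_sq_norm_inner_right g]
    simp
  have h3 : ∀ i, Integrable (fun g => ⟪stdOrthonormalBasis ℝ E i, g⟫_ℝ ^ 2) (stdGaussian E) := by
    intro i
    refine (integrable_norm_sq_stdGaussian (E := E)).mono' (by fun_prop) (ae_of_all _ fun g => ?_)
    have := abs_real_inner_le_norm (stdOrthonormalBasis ℝ E i) g
    rw [(stdOrthonormalBasis ℝ E).norm_eq_one i, one_mul] at this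
    rw [Real.norm_eq_abs, abs_pow]
    gcongr
  simp only [h2]
  rw [integral_finsetSum _ fun i _ => h3 i]
  simp [h1]

theorem integral_norm_stdGaussian_le :
    ∫ g, ‖g‖ ∂(stdGaussian E) ≤ √(Module.finrank ℝ E) := by
  rcases Nat.eq_zero_or_pos (Module.finrank ℝ E) with h0 | h0
  · have := Module.finrank_zero_iff.1 h0
    have h : ∀ g : E, ‖g‖ = 0 := fun g => by rw [Subsingleton.elim g 0, norm_zero]
    simp [h]
  · set D := √(Module.finrank ℝ E : ℝ) with hD
    have hD0 : 0 < D := Real.sqrt_pos.2 (by exact_mod_cast h0)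
    have hDD : D ^ 2 = Module.finrank ℝ E := Real.sq_sqrt (by positivity)
    -- The tangent-line form of Jensen: AM-GM, tight at ‖g‖ = D.
    have hle : ∀ g : E, ‖g‖ ≤ (2 * D)⁻¹ * ‖g‖ ^ 2 + D / 2 := by
      intro g
      have : (2 * D)⁻¹ * ‖g‖ ^ 2 + D / 2 - ‖g‖ = (2 * D)⁻¹ * (‖g‖ - D) ^ 2 := by
        field_simp
        ring
      have h2 : 0 ≤ (2 * D)⁻¹ * (‖g‖ - D) ^ 2 := by positivity
      linarith
    refine (integral_mono IsGaussian.integrable_id.norm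
      ((integrable_norm_sq_stdGaussian.const_mul _).add (integrable_const _)) hle).trans ?_
    simp only [Pi.add_apply]
    rw [integral_add (integrable_norm_sq_stdGaussian.const_mul _) (integrable_const _),
      integral_const_mul, integral_norm_sq_stdGaussian, ← hDD]
    simp
    field_simp
    linarith

/-- The uniform distribution on the unit sphere: the law of the direction of a Gaussian vector. -/
noncomputable def sphereLaw (E : Type*) [NormedAddCommGroup E] [InnerProductSpace ℝ E]
    [FiniteDimensional ℝ E] [MeasurableSpace E] : Measure E :=
  (stdGaussian E).map fun g => ‖g‖⁻¹ • g

instance isProbabilityMeasure_sphereLaw : IsProbabilityMeasure (sphereLaw E) :=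
  Measure.isProbabilityMeasure_map (by fun_prop)

theorem ae_sphereLaw_norm (hd : 2 ≤ Module.finrank ℝ E) : ∀ᵐ a ∂(sphereLaw E), ‖a‖ = 1 := by
  obtain ⟨w, hw, -⟩ := exists_unit_inner_eq_zero hd 0
  rw [sphereLaw, ae_map_iff (by fun_prop) (isClosed_eq continuous_norm
    continuous_const).measurableSet]
  filter_upwards [ae_stdGaussian_inner_ne_zero hw] with g hg
  have : g ≠ 0 := by
    rintro rfl
    simp at hg
  rw [norm_smul, norm_inv, norm_norm, inv_mul_cancel₀ (norm_ne_zero_iff.2 this)]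

/-- Vectors with direction x lie in the hyperplane orthogonal to some unit w ⟂ x, which is
Gaussian-null. -/
theorem nullSingletonClass_sphereLaw (hd : 2 ≤ Module.finrank ℝ E) :
    NullSingletonClass (sphereLaw E) := by
  refine ⟨fun x => ?_⟩
  obtain ⟨w, hw, hx⟩ := exists_unit_inner_eq_zero hd x
  rw [sphereLaw, Measure.map_apply (by fun_prop) (measurableSet_singleton x)]
  refine measure_mono_null (fun g hg => ?_) (ae_iff.1 (ae_stdGaussian_inner_ne_zero hw))
  have hg' : ‖g‖⁻¹ • g = x := hg
  simp only [ne_eq, not_not, mem_ofPred_eq]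
  rw [← norm_smul_normalize g, hg', real_inner_smul_right, real_inner_comm, hx, mul_zero]

theorem integral_sphereLaw_abs_inner (u : E) :
    ∫ a, |⟪a, u⟫_ℝ| ∂(sphereLaw E) = ∫ g, |⟪‖g‖⁻¹ • g, u⟫_ℝ| ∂(stdGaussian E) :=
  integral_map (by fun_prop) (by fun_prop)

/-- The reflection exchanging u and v preserves the Gaussian law. -/
theorem integral_sphereLaw_congr {u v : E} (h : ‖u‖ = ‖v‖) :
    ∫ a, |⟪a, u⟫_ℝ| ∂(sphereLaw E) = ∫ a, |⟪a, v⟫_ℝ| ∂(sphereLaw E) := by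
  rw [integral_sphereLaw_abs_inner, integral_sphereLaw_abs_inner]
  set f := (ℝ ∙ (u - v))ᗮ.reflection with hf
  have hfu : f u = v := Submodule.reflection_sub h
  conv_rhs => rw [← stdGaussian_map f]
  rw [integral_map f.continuous.aemeasurable
    (Measurable.aestronglyMeasurable (by fun_prop)), ← hfu]
  refine integral_congr_ae (ae_of_all _ fun g => ?_)
  simp only [LinearIsometryEquiv.norm_map, ← map_smul, LinearIsometryEquiv.inner_map_map]

/-- The mean width constant of the sphere and its lower bound. -/
theorem exists_sphereLaw_const (hd : 2 ≤ Module.finrank ℝ E) :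
    ∃ r : ℝ, (∀ u : E, ∫ a, |⟪a, u⟫_ℝ| ∂(sphereLaw E) = r * ‖u‖) ∧
      √(2 / Real.pi) ≤ r * √(Module.finrank ℝ E) := by
  obtain ⟨w, hw, -⟩ := exists_unit_inner_eq_zero hd 0
  have hr : ∀ u : E, ∫ a, |⟪a, u⟫_ℝ| ∂(sphereLaw E) =
      (∫ a, |⟪a, w⟫_ℝ| ∂(sphereLaw E)) * ‖u‖ := by
    intro u
    rw [integral_sphereLaw_congr (v := ‖u‖ • w) (by rw [norm_smul, norm_norm, hw, mul_one]),
      ← integral_mul_const]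
    simp only [real_inner_smul_right, abs_mul, abs_norm]
    simp only [mul_comm]
  refine ⟨_, hr, ?_⟩
  set r := ∫ a, |⟪a, w⟫_ℝ| ∂(sphereLaw E)
  have hr0 : 0 ≤ r := integral_nonneg fun a => abs_nonneg _
  have hnorm := ae_sphereLaw_norm hd
  have hint : Integrable (Function.uncurry fun (a g : E) => |⟪a, g⟫_ℝ|)
      ((sphereLaw E).prod (stdGaussian E)) := by
    have h1 : Integrable (fun p : E × E => ‖p.2‖) ((sphereLaw E).prod (stdGaussian E)) :=
      (measurePreserving_snd (μ := sphereLaw E) (ν := stdGaussian E)).integrable_comp_of_integrable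
        (IsGaussian.integrable_id (μ := stdGaussian E)).norm
    refine h1.mono' (Continuous.aestronglyMeasurable (by fun_prop)) ?_
    filter_upwards [(measurePreserving_fst (μ := sphereLaw E)
      (ν := stdGaussian E)).quasiMeasurePreserving.ae hnorm] with p hp
    simpa [Function.uncurry, hp] using abs_real_inner_le_norm p.1 p.2
  -- For independent uniform a and Gaussian g, the mean of |⟪a, g⟫| is √(2/π) integrating over g
  -- first, and r times the mean of ‖g‖ integrating over a first.
  have hswap := integral_integral_swap hint
  simp only [hr] at hswap
  have hleft : ∫ a, ∫ g, |⟪a, g⟫_ℝ| ∂(stdGaussian E) ∂(sphereLaw E) = √(2 / Real.pi) := by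
    rw [integral_congr_ae (g := fun _ => √(2 / Real.pi))]
    · simp
    · filter_upwards [hnorm] with a ha
      exact integral_abs_inner_stdGaussian ha
  rw [hleft, integral_const_mul] at hswap
  rw [hswap]
  exact mul_le_mul_of_nonneg_left integral_norm_stdGaussian_le hr0

end Sphere

/-! ### Covering an annulus by balls -/

section Covering

variable {E : Type*} [NormedAddCommGroup E] [InnerProductSpace ℝ E]

/-- The squared distance is at most ρ² + c² - 2ρc², and its excess over 1 - c² factors as (ρ - 1)(ρ
- (2c² - 1)) ≤ 0. -/
theorem norm_sub_smul_le {c ρ : ℝ} (hc : 0 ≤ c) (hρ : 0 ≤ ρ) (hρ1 : ρ ≤ 1)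
    (hρc : 2 * c ^ 2 - 1 ≤ ρ) {u v : E} (hu : ‖u‖ = 1) (hv : ‖v‖ = 1) (h : c ≤ ⟪u, v⟫_ℝ) :
    ‖ρ • u - c • v‖ ≤ √(1 - c ^ 2) := by
  refine Real.le_sqrt_of_sq_le ?_
  rw [norm_sub_sq_real, norm_smul, norm_smul, hu, hv, real_inner_smul_left,
    real_inner_smul_right, Real.norm_of_nonneg hc, Real.norm_of_nonneg hρ]
  nlinarith [mul_le_mul_of_nonneg_left h (mul_nonneg hρ hc),
    mul_nonneg (sub_nonneg.2 hρ1) (sub_nonneg.2 hρc), hρ]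

variable [FiniteDimensional ℝ E]

/-- A finite set in a ball of radius `R` whose support function is at least `c * R` on the unit
sphere gives a covering of an annulus, hence a lower bound for its cardinality. -/
theorem one_sub_pow_le_card_mul [Nontrivial E] {Q : Finset E} {c R : ℝ} (hc : 0 < c)
    (hR : 0 < R) (hQ : ∀ q ∈ Q, ‖q‖ ≤ R) (h : ∀ u : E, ‖u‖ = 1 → ∃ q ∈ Q, c * R ≤ ⟪q, u⟫_ℝ) :
    1 - max 0 (2 * c ^ 2 - 1) ^ Module.finrank ℝ E ≤
      Q.card * √(1 - c ^ 2) ^ Module.finrank ℝ E := by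
  borelize E
  set ρ := max 0 (2 * c ^ 2 - 1) with hρ
  have hρ0 : 0 ≤ ρ := le_max_left _ _
  let μ : Measure E := Measure.addHaar
  have hsub : Metric.closedBall (0 : E) 1 ⊆ Metric.closedBall 0 ρ ∪
      ⋃ q ∈ Q, Metric.closedBall (c • (‖q‖⁻¹ • q)) (√(1 - c ^ 2)) := by
    intro x hx
    rw [mem_closedBall_zero_iff] at hx
    rcases le_total ‖x‖ ρ with hxρ | hxρ
    · exact Or.inl (mem_closedBall_zero_iff.2 hxρ)
    right
    obtain ⟨u, hu, hxu⟩ : ∃ u : E, ‖u‖ = 1 ∧ x = ‖x‖ • u := by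
      rcases eq_or_ne x 0 with rfl | hx0
      · obtain ⟨u, hu⟩ := exists_norm_eq E zero_le_one
        exact ⟨u, hu, by simp⟩
      · exact ⟨‖x‖⁻¹ • x, by
          rw [norm_smul, norm_inv, norm_norm, inv_mul_cancel₀ (norm_ne_zero_iff.2 hx0)],
          (norm_smul_normalize x).symm⟩
    obtain ⟨q, hq, hqu⟩ := h u hu
    have hq0 : q ≠ 0 := by
      rintro rfl
      rw [inner_zero_left] at hqu
      exact absurd hqu (not_le.2 (by positivity))
    have hqn : 0 < ‖q‖ := norm_pos_iff.2 hq0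
    refine mem_iUnion₂.2 ⟨q, hq, ?_⟩
    rw [Metric.mem_closedBall, dist_eq_norm, hxu]
    refine norm_sub_smul_le hc.le (norm_nonneg x) hx ((le_max_right _ _).trans hxρ) hu ?_ ?_
    · rw [norm_smul, norm_inv, norm_norm, inv_mul_cancel₀ hqn.ne']
    · rw [real_inner_smul_right, real_inner_comm, inv_mul_eq_div, le_div_iff₀ hqn]
      exact (mul_le_mul_of_nonneg_left (hQ q hq) hc.le).trans hqu
  have hfin : μ (Metric.closedBall 0 ρ ∪
      ⋃ q ∈ Q, Metric.closedBall (c • (‖q‖⁻¹ • q)) (√(1 - c ^ 2))) ≠ ⊤ :=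
    ((isCompact_closedBall _ _).union (Q.isCompact_biUnion fun q _ =>
      isCompact_closedBall _ _)).measure_lt_top.ne
  have h1 := (measureReal_mono hsub hfin).trans ((measureReal_union_le _ _).trans
    (add_le_add_right (measureReal_biUnion_finset_le Q _) _))
  simp only [Measure.addHaar_real_closedBall μ _ hρ0,
    Measure.addHaar_real_closedBall μ _ zero_le_one,
    Measure.addHaar_real_closedBall μ _ (Real.sqrt_nonneg _), one_pow, one_mul,
    Finset.sum_const, nsmul_eq_mul] at h1
  have hV : 0 < μ.real (Metric.ball (0 : E) 1) :=
    ENNReal.toReal_pos (Metric.measure_ball_pos μ 0 one_pos).ne' measure_ball_lt_top.ne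
  refine le_of_mul_le_mul_right ?_ hV
  linarith

end Covering

/-! ### Numerical estimates -/

section Numerics

theorem one_add_pow_ge {x : ℝ} (hx : 0 ≤ x) (n : ℕ) :
    1 + n * x + n * (n - 1) / 2 * x ^ 2 ≤ (1 + x) ^ n := by
  induction n with
  | zero => simp
  | succ n ih =>
    rw [pow_succ (1 + x)]
    have h := mul_le_mul_of_nonneg_right ih (by linarith : 0 ≤ 1 + x)
    have h2 : 0 ≤ (n : ℝ) * (n - 1) / 2 * x ^ 3 := by
      rcases n with _ | n
      · simp
      · push_cast
        have : (n : ℝ) + 1 - 1 = n := by ring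
        rw [this]
        positivity
    have h3 : (1 + n * x + n * (n - 1) / 2 * x ^ 2) * (1 + x) =
        1 + ((n + 1 : ℕ) : ℝ) * x + ((n + 1 : ℕ) : ℝ) * (((n + 1 : ℕ) : ℝ) - 1) / 2 * x ^ 2 +
          n * (n - 1) / 2 * x ^ 3 := by
      push_cast
      ring
    linarith

theorem rpow_sq_eq {d : ℕ} (hd : 1 ≤ d) :
    (((d : ℝ) / 64) ^ (((d : ℝ) - 1) / 4)) ^ 2 = (√d / 8) ^ (d - 1) := by
  have h1 : (d : ℝ) / 64 = (√d / 8) ^ (2 : ℝ) := by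
    rw [Real.rpow_two, div_pow, Real.sq_sqrt (by positivity)]
    norm_num
  rw [h1, ← Real.rpow_mul (by positivity), ← Real.rpow_mul_natCast (by positivity),
    ← Real.rpow_natCast]
  congr 1
  push_cast [Nat.cast_sub hd]
  ring

theorem fifty_mul_sqrt_le {d : ℕ} (hd : 3 ≤ d) :
    50 * √d ≤ ((1 + 11 / (10 * √d)) ^ d) ^ 2 * (20 / 11) ^ d := by
  have hd' : (3 : ℝ) ≤ d := by exact_mod_cast hd
  set y := √(d : ℝ) with hy
  have hyy : y ^ 2 = d := Real.sq_sqrt (by positivity)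
  have hy1 : 1.732 ≤ y := Real.le_sqrt_of_sq_le (by norm_num; linarith)
  have h1 : (6 : ℝ) ≤ (20 / 11) ^ d :=
    le_trans (by norm_num) (pow_le_pow_right₀ (by norm_num : (1 : ℝ) ≤ 20 / 11) hd)
  have h2 := one_add_pow_ge (x := 11 / (10 * y)) (by positivity) d
  have h3 : 1 + (d : ℝ) * (11 / (10 * y)) + d * (d - 1) / 2 * (11 / (10 * y)) ^ 2 =
      0.395 + 1.1 * y + 0.605 * y ^ 2 := by
    rw [← hyy]
    field_simp
    ring
  rw [h3] at h2
  have h4 : 4.1 ≤ (1 + 11 / (10 * y)) ^ d := by nlinarith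
  have h5 : 2.147 * y ≤ (1 + 11 / (10 * y)) ^ d := by nlinarith
  calc 50 * y ≤ (4.1 * (2.147 * y)) * 6 := by linarith
    _ ≤ ((1 + 11 / (10 * y)) ^ d) ^ 2 * (20 / 11) ^ d := by
      rw [sq]
      gcongr

theorem pow_annulus_le {d : ℕ} (hd : 3 ≤ d) {η c : ℝ} (hη : η = 11 / (10 * √d))
    (hc : 1 - c ^ 2 = 4 * η / (1 + η) ^ 2) : max 0 (2 * c ^ 2 - 1) ^ d ≤ 1 / 5 := by
  have hd' : (3 : ℝ) ≤ d := by exact_mod_cast hd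
  have hyy : √(d : ℝ) ^ 2 = d := Real.sq_sqrt (by positivity)
  have hy1 : 1.732 ≤ √(d : ℝ) := Real.le_sqrt_of_sq_le (by norm_num; linarith)
  have hη0 : 0 < η := by rw [hη]; positivity
  have hη1 : η ≤ 1 := by
    rw [hη, div_le_one (by positivity)]
    linarith
  have hs : η ≤ 1 - c ^ 2 := by
    rw [hc, le_div_iff₀ (by positivity)]
    have : (1 + η) ^ 2 ≤ 4 := by nlinarith
    nlinarith
  -- From 1 - c² ≥ η: 2c² - 1 ≤ 1 - 2η ≤ exp(-2η).
  have hle : max 0 (2 * c ^ 2 - 1) ≤ Real.exp (-(2 * η)) :=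
    max_le (Real.exp_pos _).le (by linarith [Real.add_one_le_exp (-(2 * η))])
  have hdη : 3.8 ≤ d * (2 * η) := by
    have : (d : ℝ) * (2 * η) = 2.2 * √d := by
      rw [hη]
      nth_rewrite 1 [← hyy]
      field_simp
      ring
    rw [this]
    linarith
  calc max 0 (2 * c ^ 2 - 1) ^ d ≤ Real.exp (-(2 * η)) ^ d :=
        pow_le_pow_left₀ (le_max_left _ _) hle d
    _ = Real.exp (-(d * (2 * η))) := by rw [← Real.exp_nat_mul]; congr 1; ring
    _ ≤ 1 / 5 := by
      rw [Real.exp_neg, ← one_div]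
      refine one_div_le_one_div_of_le (by norm_num) ?_
      have := Real.quadratic_le_exp_of_nonneg (x := d * (2 * η)) (by positivity)
      nlinarith

theorem card_lower_bound {d N : ℕ} (hd : 2 ≤ d) {η c : ℝ} (hη : η = 11 / (10 * √d))
    (hc : c = (1 - η) / (1 + η))
    (h : 1 - max 0 (2 * c ^ 2 - 1) ^ d ≤ N * √(1 - c ^ 2) ^ d) :
    2 * √d * ((d : ℝ) / 64) ^ (((d : ℝ) - 1) / 4) ≤ N := by
  have hd' : (2 : ℝ) ≤ d := by exact_mod_cast hd
  have hy0 : 0 < √(d : ℝ) := Real.sqrt_pos.2 (by linarith)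
  have hη0 : 0 < η := by rw [hη]; positivity
  have hcs : 1 - c ^ 2 = 4 * η / (1 + η) ^ 2 := by
    rw [hc]
    field_simp
    ring
  refine le_of_sq_le_sq ?_ (Nat.cast_nonneg N)
  rw [mul_pow, rpow_sq_eq (by omega), mul_pow]
  rcases hd.eq_or_lt with rfl | hd3
  · have hs2 : √2 ^ 2 = (2 : ℝ) := Real.sq_sqrt (by norm_num)
    have hlo : 1.414 ≤ √(2 : ℝ) := Real.le_sqrt_of_sq_le (by norm_num)
    have hhi : √(2 : ℝ) ≤ 1.415 := Real.sqrt_le_iff.2 (by norm_num)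
    push_cast at *
    have hη1 : 0.777 ≤ η := by
      rw [hη, le_div_iff₀ (by positivity)]
      linarith
    have hη2 : η ≤ 0.778 := by
      rw [hη, div_le_iff₀ (by positivity)]
      linarith
    have hc0 : 0 < c := by
      rw [hc]
      exact div_pos (by linarith) (by linarith)
    have hc1 : c ≤ 1 / 2 := by
      rw [hc, div_le_iff₀ (by linarith)]
      linarith
    -- For d = 2 it suffices that N ≥ 2: as c ≤ 1/2 the annulus is the whole disc, and one ball of
    -- radius below 1 cannot cover it.
    have hN : 2 ≤ N := by
      by_contra hN
      have hN' : (N : ℝ) ≤ 1 := by exact_mod_cast (by omega : N ≤ 1)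
      rw [max_eq_left (by nlinarith), Real.sq_sqrt (by nlinarith)] at h
      have := mul_le_mul_of_nonneg_right hN' (by nlinarith : 0 ≤ 1 - c ^ 2)
      nlinarith
    have hN' : (2 : ℝ) ≤ N := by exact_mod_cast hN
    rw [hs2]
    norm_num
    nlinarith
  · have hann := pow_annulus_le hd3 hη hcs
    have hs0 : 0 ≤ 1 - c ^ 2 := by rw [hcs]; positivity
    have h1 : 4 / 5 ≤ N * √(1 - c ^ 2) ^ d := by linarith
    have h2 : 16 / 25 ≤ (N : ℝ) ^ 2 * (1 - c ^ 2) ^ d := by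
      have := pow_le_pow_left₀ (by norm_num) h1 2
      rw [mul_pow, ← pow_mul, mul_comm d 2, pow_mul, Real.sq_sqrt hs0] at this
      exact le_trans (by norm_num) this
    -- This factors 1/(1 - c²) so that √d/8 yields the target power, leaving a surplus controlled by
    -- `fifty_mul_sqrt_le`.
    have h3 : (1 - c ^ 2) * ((1 + η) ^ 2 * (20 / 11) * (√d / 8)) = 1 := by
      rw [hcs, hη]
      field_simp
      ring
    have h4 : (N : ℝ) ^ 2 = (N : ℝ) ^ 2 * (1 - c ^ 2) ^ d *
        ((1 + η) ^ 2 * (20 / 11) * (√d / 8)) ^ d := by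
      rw [mul_assoc, ← mul_pow, h3, one_pow, mul_one]
    have h5 := fifty_mul_sqrt_le hd3
    rw [← hη] at h5
    rw [h4]
    refine le_trans ?_ (mul_le_mul_of_nonneg_right h2 (by positivity))
    obtain ⟨k, rfl⟩ : ∃ k, d = k + 1 := ⟨d - 1, by omega⟩
    rw [Nat.add_sub_cancel, mul_pow _ (√((k + 1 : ℕ) : ℝ) / 8), pow_succ (√((k + 1 : ℕ) : ℝ) / 8),
      mul_pow ((1 + η) ^ 2), ← pow_mul, mul_comm 2 (k + 1), pow_mul]
    set y := √((k + 1 : ℕ) : ℝ) with hy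
    have hk : 0 ≤ (y / 8) ^ k := by positivity
    have h6 := mul_le_mul_of_nonneg_right (mul_le_mul_of_nonneg_right h5 hk) hy0.le
    calc 2 ^ 2 * y ^ 2 * (y / 8) ^ k = 50 * y * (y / 8) ^ k * y * (2 / 25) := by ring
      _ ≤ ((1 + η) ^ (k + 1)) ^ 2 * (20 / 11) ^ (k + 1) * (y / 8) ^ k * y * (2 / 25) := by
        gcongr
      _ = _ := by ring

end Numerics

/-! ### Square roots at infinity -/

section Asymptotics

theorem le_of_forall_sub_le_sqrt {A b K t₀ : ℝ} (hA : 0 ≤ A) (hK : 0 ≤ K)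
    (h : ∀ t, t₀ ≤ t → t - A ≤ √(t ^ 2 - 2 * t * b + K)) : b ≤ A := by
  by_contra hb
  rw [not_le] at hb
  have hpos : 0 < b - A := sub_pos.2 hb
  -- Squaring gives 2t(b - A) + A² ≤ K, which fails for this t.
  set t := max t₀ (A + (K + 1) / (b - A)) with ht
  have ht1 : A + (K + 1) / (b - A) ≤ t := le_max_right _ _
  have h0 : 0 < (K + 1) / (b - A) := by positivity
  have h1 := h t (le_max_left _ _)
  have h3 : 0 < t - A := by linarith
  have h4 := (Real.le_sqrt' h3).1 h1
  have h5 : K + 1 ≤ t * (b - A) := by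
    rw [← div_le_iff₀ hpos]
    linarith
  nlinarith [sq_nonneg A]

theorem sub_le_of_forall_sub_le_sqrt {A b ε : ℝ} (hA1 : A ≤ 1)
    (h : ∀ t, 2 ≤ t → t - b ≤ √(t ^ 2 + 1 - 2 * t * A) + ε) : A - ε ≤ b := by
  refine le_of_forall_pos_le_add fun τ hτ => ?_
  set t := max 2 (1 / τ) with ht
  have ht2 : 2 ≤ t := le_max_left _ _
  have htτ : 1 / t ≤ τ := by
    rw [div_le_comm₀ (by linarith) hτ]
    exact le_max_right _ _
  have h1 := h t ht2
  have h2 : √(t ^ 2 + 1 - 2 * t * A) ≤ t - A + 1 / t := by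
    have ht0 : 0 < 1 / t := by positivity
    refine Real.sqrt_le_iff.2 ⟨by linarith, ?_⟩
    have h3 : t * (1 / t) = 1 := by field_simp
    have h4 : A * (1 / t) ≤ 1 / 2 := by
      have : 1 / t ≤ 1 / 2 := one_div_le_one_div_of_le (by norm_num) ht2
      nlinarith
    nlinarith [sq_nonneg A, sq_nonneg (1 / t)]
  linarith

end Asymptotics

/-! ### Support function of the sites -/

section DistLike

variable {d : ℕ} {Q : Finset (EuclideanSpace ℝ (Fin d))} {w : EuclideanSpace ℝ (Fin d) → ℝ}

theorem norm_smul_sub_sq {u q : EuclideanSpace ℝ (Fin d)} (hu : ‖u‖ = 1) (t : ℝ) :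
    ‖t • u - q‖ ^ 2 = t ^ 2 - 2 * t * ⟪q, u⟫_ℝ + ‖q‖ ^ 2 := by
  rw [norm_sub_sq_real, norm_smul, hu, real_inner_smul_left, real_inner_comm, mul_one,
    Real.norm_eq_abs, sq_abs]
  ring

theorem distLike_le {q : EuclideanSpace ℝ (Fin d)} (hq : q ∈ Q) (x : EuclideanSpace ℝ (Fin d)) :
    distLike Q w x ≤ √(‖x - q‖ ^ 2 + w q) :=
  Real.sqrt_le_sqrt (ciInf_le (Set.finite_range _).bddBelow (⟨q, hq⟩ : {q // q ∈ Q}))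

theorem exists_distLike_eq (hQ : Q.Nonempty) (x : EuclideanSpace ℝ (Fin d)) :
    ∃ q ∈ Q, distLike Q w x = √(‖x - q‖ ^ 2 + w q) := by
  have := hQ.to_subtype
  obtain ⟨q, hq⟩ := exists_eq_ciInf_of_finite
    (f := fun q : {q // q ∈ Q} => ‖x - q.1‖ ^ 2 + w q.1)
  exact ⟨q.1, q.2, by rw [distLike, ← hq]⟩

/-- A uniform approximation of a function behaving like `√(t² + 1 - 2 t A)` along a ray forces
the support function of the sites to be close to `A` in the direction of the ray. -/
theorem support_close (hQ : Q.Nonempty) (hw : ∀ q ∈ Q, 0 ≤ w q)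
    {φ : EuclideanSpace ℝ (Fin d) → ℝ} {ε A : ℝ} (hε : 0 ≤ ε)
    (h : ∀ x, |φ x - distLike Q w x| ≤ ε) {u : EuclideanSpace ℝ (Fin d)} (hu : ‖u‖ = 1)
    (hA0 : 0 ≤ A) (hA1 : A ≤ 1) (hφ : ∀ t, 0 ≤ t → φ (t • u) = √(t ^ 2 + 1 - 2 * t * A)) :
    (∀ q ∈ Q, ⟪q, u⟫_ℝ ≤ A + ε) ∧ ∃ q ∈ Q, A - ε ≤ ⟪q, u⟫_ℝ := by
  constructor
  · intro q hq
    refine le_of_forall_sub_le_sqrt (K := ‖q‖ ^ 2 + w q) (t₀ := 0) (by linarith)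
      (add_nonneg (sq_nonneg _) (hw q hq)) fun t ht => ?_
    have h1 := (abs_le.1 (h (t • u))).2
    rw [hφ t ht] at h1
    have h2 : t - A ≤ √(t ^ 2 + 1 - 2 * t * A) := Real.le_sqrt_of_sq_le (by nlinarith)
    have h3 := distLike_le (w := w) hq (t • u)
    rw [norm_smul_sub_sq hu, add_assoc] at h3
    linarith
  -- The site p attaining the minimum depends on t; the maximizer q of ⟪·, u⟫ serves all t at once.
  · obtain ⟨q, hq, hmax⟩ := Q.exists_max_image (fun q => ⟪q, u⟫_ℝ) hQ
    refine ⟨q, hq, sub_le_of_forall_sub_le_sqrt hA1 fun t ht => ?_⟩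
    have h1 := (abs_le.1 (h (t • u))).1
    obtain ⟨p, hp, hpt⟩ := exists_distLike_eq (w := w) hQ (t • u)
    rw [hφ t (by linarith), hpt, norm_smul_sub_sq hu] at h1
    have h2 : t - ⟪p, u⟫_ℝ ≤ √(t ^ 2 - 2 * t * ⟪p, u⟫_ℝ + ‖p‖ ^ 2 + w p) := by
      refine Real.le_sqrt_of_sq_le ?_
      have h3 := abs_real_inner_le_norm p u
      rw [hu, mul_one] at h3
      have h4 := sq_le_sq' (abs_le.1 h3).1 (abs_le.1 h3).2
      nlinarith [hw p hp]
    have := hmax p hp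
    linarith

end DistLike

/-! ### Halving distance of an antipodal set -/

section Symmetric

variable {d m : ℕ}

/-- The symmetric point set `{± a i}`. -/
noncomputable def symmSet (a : Fin m → EuclideanSpace ℝ (Fin d)) :
    Finset (EuclideanSpace ℝ (Fin d)) :=
  Finset.univ.image a ∪ Finset.univ.image fun i => -a i

variable {a : Fin m → EuclideanSpace ℝ (Fin d)}

theorem mem_symmSet {p : EuclideanSpace ℝ (Fin d)} :
    p ∈ symmSet a ↔ (∃ i, a i = p) ∨ ∃ i, -a i = p := by
  simp [symmSet]

theorem norm_of_mem_symmSet (ha : ∀ i, ‖a i‖ = 1) {p : EuclideanSpace ℝ (Fin d)}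
    (hp : p ∈ symmSet a) : ‖p‖ = 1 := by
  rcases mem_symmSet.1 hp with ⟨i, rfl⟩ | ⟨i, rfl⟩
  · exact ha i
  · rw [norm_neg, ha i]

theorem ne_neg_of_norm (ha : ∀ i, ‖a i‖ = 1) (h : ∀ i j, i ≠ j → a i ≠ a j ∧ a i ≠ -a j)
    (i j : Fin m) : a i ≠ -a j := by
  rcases eq_or_ne i j with rfl | hij
  · intro h'
    have h0 : a i = 0 := by
      have h2 : (2 : ℝ) • a i = 0 := by rw [two_smul, ← sub_neg_eq_add, ← h', sub_self]
      exact (smul_eq_zero.1 h2).resolve_left two_ne_zero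
    simpa [h0] using ha i
  · exact (h i j hij).2

theorem injective_of_ne (h : ∀ i j, i ≠ j → a i ≠ a j ∧ a i ≠ -a j) : Function.Injective a :=
  fun i j hij => by
    by_contra hne
    exact (h i j hne).1 hij

theorem symmSet_disjoint (ha : ∀ i, ‖a i‖ = 1) (h : ∀ i j, i ≠ j → a i ≠ a j ∧ a i ≠ -a j) :
    Disjoint (Finset.univ.image a) (Finset.univ.image fun i => -a i) := by
  rw [Finset.disjoint_left]
  intro p hp hp'
  obtain ⟨i, -, rfl⟩ := Finset.mem_image.1 hp
  obtain ⟨j, -, hj⟩ := Finset.mem_image.1 hp'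
  exact ne_neg_of_norm ha h i j hj.symm

theorem sum_symmSet (ha : ∀ i, ‖a i‖ = 1) (h : ∀ i j, i ≠ j → a i ≠ a j ∧ a i ≠ -a j)
    (f : EuclideanSpace ℝ (Fin d) → ℝ) :
    ∑ p ∈ symmSet a, f p = ∑ i, (f (a i) + f (-a i)) := by
  have hinj := injective_of_ne h
  have hinj' : Function.Injective fun i => -a i := neg_injective.comp hinj
  rw [symmSet, Finset.sum_union (symmSet_disjoint ha h), Finset.sum_image hinj.injOn,
    Finset.sum_image hinj'.injOn, Finset.sum_add_distrib]

theorem card_symmSet (ha : ∀ i, ‖a i‖ = 1) (h : ∀ i j, i ≠ j → a i ≠ a j ∧ a i ≠ -a j) :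
    (symmSet a).card = 2 * m := by
  have hinj := injective_of_ne h
  have hinj' : Function.Injective fun i => -a i := neg_injective.comp hinj
  rw [symmSet, Finset.card_union_of_disjoint (symmSet_disjoint ha h),
    Finset.card_image_of_injective _ hinj,
    Finset.card_image_of_injective _ hinj', Finset.card_univ,
    Fintype.card_fin]
  omega

/-- Discarding negative terms and then enlarging T to the whole set leaves |⟪a i, x⟫| from each
antipodal pair. -/
theorem sum_inner_le (ha : ∀ i, ‖a i‖ = 1) (h : ∀ i j, i ≠ j → a i ≠ a j ∧ a i ≠ -a j)
    {T : Finset (EuclideanSpace ℝ (Fin d))} (hT : T ⊆ symmSet a)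
    (x : EuclideanSpace ℝ (Fin d)) : ∑ p ∈ T, ⟪p, x⟫_ℝ ≤ ∑ i, |⟪a i, x⟫_ℝ| := by
  calc ∑ p ∈ T, ⟪p, x⟫_ℝ ≤ ∑ p ∈ T, max ⟪p, x⟫_ℝ 0 :=
        Finset.sum_le_sum fun p _ => le_max_left _ _
    _ ≤ ∑ p ∈ symmSet a, max ⟪p, x⟫_ℝ 0 :=
        Finset.sum_le_sum_of_subset_of_nonneg hT fun p _ _ => le_max_right _ _
    _ = ∑ i, |⟪a i, x⟫_ℝ| := by
        rw [sum_symmSet ha h]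
        refine Finset.sum_congr rfl fun i _ => ?_
        rw [inner_neg_left]
        rcases le_total 0 ⟪a i, x⟫_ℝ with h0 | h0
        · rw [max_eq_left h0, max_eq_right (by linarith), abs_of_nonneg h0, add_zero]
        · rw [max_eq_right h0, max_eq_left (by linarith), abs_of_nonpos h0, zero_add]

theorem exists_sum_inner_eq (ha : ∀ i, ‖a i‖ = 1) (h : ∀ i j, i ≠ j → a i ≠ a j ∧ a i ≠ -a j)
    (x : EuclideanSpace ℝ (Fin d)) : ∃ T ∈ (symmSet a).powersetCard m,
      ∑ p ∈ T, ⟪p, x⟫_ℝ = ∑ i, |⟪a i, x⟫_ℝ| := by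
  set b : Fin m → EuclideanSpace ℝ (Fin d) := fun i => if 0 ≤ ⟪a i, x⟫_ℝ then a i else -a i with hb
  have hbinj : Function.Injective b := by
    intro i j hij
    have hinj := injective_of_ne h
    have hne := ne_neg_of_norm ha h
    simp only [hb] at hij
    split_ifs at hij with h1 h2 h2
    · exact hinj hij
    · exact absurd hij (hne i j)
    · exact absurd hij.symm (hne j i)
    · exact hinj (neg_injective hij)
  refine ⟨Finset.univ.image b, ?_, ?_⟩
  · rw [Finset.mem_powersetCard, Finset.card_image_of_injective _ hbinj, Finset.card_univ,
      Fintype.card_fin]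
    refine ⟨fun p hp => ?_, rfl⟩
    obtain ⟨i, -, rfl⟩ := Finset.mem_image.1 hp
    rw [mem_symmSet]
    simp only [hb]
    split_ifs
    · exact Or.inl ⟨i, rfl⟩
    · exact Or.inr ⟨i, rfl⟩
  · rw [Finset.sum_image hbinj.injOn]
    refine Finset.sum_congr rfl fun i _ => ?_
    simp only [hb]
    split_ifs with h0
    · rw [abs_of_nonneg h0]
    · rw [inner_neg_left, abs_of_neg (not_le.1 h0)]

theorem sum_norm_sub_sq {k : ℕ} {P T : Finset (EuclideanSpace ℝ (Fin d))}
    (hP : ∀ p ∈ P, ‖p‖ = 1) (hT : T ∈ P.powersetCard k) (x : EuclideanSpace ℝ (Fin d)) :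
    ∑ p ∈ T, ‖x - p‖ ^ 2 = k * (‖x‖ ^ 2 + 1) - 2 * ∑ p ∈ T, ⟪p, x⟫_ℝ := by
  obtain ⟨hsub, hcard⟩ := Finset.mem_powersetCard.1 hT
  have h1 : ∀ p ∈ T, ‖x - p‖ ^ 2 = (‖x‖ ^ 2 + 1) - 2 * ⟪p, x⟫_ℝ := by
    intro p hp
    rw [norm_sub_sq_real, hP p (hsub hp), real_inner_comm]
    ring
  rw [Finset.sum_congr rfl h1, Finset.sum_sub_distrib, ← Finset.mul_sum, Finset.sum_const, hcard,
    nsmul_eq_mul]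

/-- The halving distance of a symmetric set in terms of the support function of a zonotope. -/
theorem kDist_symmSet (hm : 0 < m) (ha : ∀ i, ‖a i‖ = 1)
    (h : ∀ i j, i ≠ j → a i ≠ a j ∧ a i ≠ -a j) (x : EuclideanSpace ℝ (Fin d)) :
    kDist (symmSet a) m x = √(‖x‖ ^ 2 + 1 - 2 * ((1 / m) * ∑ i, |⟪a i, x⟫_ℝ|)) := by
  have hP : ∀ p ∈ symmSet a, ‖p‖ = 1 := fun p hp => norm_of_mem_symmSet ha hp
  obtain ⟨T, hT, hTx⟩ := exists_sum_inner_eq ha h x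
  have : Nonempty {T // T ∈ (symmSet a).powersetCard m} := ⟨⟨T, hT⟩⟩
  have hinf : ⨅ T : {T // T ∈ (symmSet a).powersetCard m}, ∑ p ∈ T.1, ‖x - p‖ ^ 2 =
      m * (‖x‖ ^ 2 + 1) - 2 * ∑ i, |⟪a i, x⟫_ℝ| := by
    refine le_antisymm ((ciInf_le (Set.finite_range _).bddBelow ⟨T, hT⟩).trans ?_)
      (le_ciInf fun T => ?_)
    · rw [sum_norm_sub_sq hP hT, hTx]
    · rw [sum_norm_sub_sq hP T.2]
      linarith [sum_inner_le ha h (Finset.mem_powersetCard.1 T.2).1 x]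
  have hm' : (m : ℝ) ≠ 0 := by exact_mod_cast hm.ne'
  rw [kDist, hinf]
  congr 1
  field_simp

/-- A `k`-distance to points of the unit sphere is itself distance-like. -/
theorem exists_isApprox_kDist {k : ℕ} (hk : 0 < k) {P : Finset (EuclideanSpace ℝ (Fin d))}
    (hP : ∀ p ∈ P, ‖p‖ = 1) (hcard : k ≤ P.card) {ε : ℝ} (hε : 0 ≤ ε) :
    ∃ n, IsApprox (kDist P k) ε n := by
  have hk' : (0 : ℝ) < k := by exact_mod_cast hk
  set b : Finset (EuclideanSpace ℝ (Fin d)) → EuclideanSpace ℝ (Fin d) :=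
    fun T => (1 / (k : ℝ)) • ∑ p ∈ T, p with hb
  have hne : (P.powersetCard k).Nonempty := Finset.powersetCard_nonempty.2 hcard
  -- Expansion about the barycentre; on the unit sphere the variance term depends on T only through
  -- `b T`, so it is a weight on sites.
  have key : ∀ T ∈ P.powersetCard k, ∀ x,
      (1 / (k : ℝ)) * ∑ p ∈ T, ‖x - p‖ ^ 2 = ‖x - b T‖ ^ 2 + (1 - ‖b T‖ ^ 2) := by
    intro T hT x
    rw [sum_norm_sub_sq hP hT, norm_sub_sq_real, hb, real_inner_smul_right, inner_sum]
    simp only [real_inner_comm x]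
    field_simp
    ring
  refine ⟨_, (P.powersetCard k).image b, fun q => 1 - ‖q‖ ^ 2, hne.image b, ?_, rfl, fun x => ?_⟩
  · intro q hq
    obtain ⟨T, hT, rfl⟩ := Finset.mem_image.1 hq
    have hTc := Finset.mem_powersetCard.1 hT
    have h1 : ‖b T‖ ≤ 1 := by
      rw [hb, norm_smul, Real.norm_of_nonneg (by positivity), one_div, inv_mul_le_iff₀ hk', mul_one]
      refine (norm_sum_le _ _).trans (le_of_eq ?_)
      rw [Finset.sum_congr rfl fun p hp => hP p (hTc.1 hp)]
      simp [hTc.2]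
    have := norm_nonneg (b T)
    simp only
    nlinarith
  · have hT0 : Nonempty {T // T ∈ P.powersetCard k} := hne.to_subtype
    have hq0 : Nonempty {q // q ∈ (P.powersetCard k).image b} := (hne.image b).to_subtype
    have heq : kDist P k x = distLike ((P.powersetCard k).image b) (fun q => 1 - ‖q‖ ^ 2) x := by
      rw [kDist, distLike, Real.mul_iInf_of_nonneg (by positivity)]
      congr 1
      refine le_antisymm (le_ciInf fun q => ?_) (le_ciInf fun T => ?_)
      · obtain ⟨T, hT, hTq⟩ := Finset.mem_image.1 q.2
        rw [← hTq, ← key T hT]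
        exact ciInf_le (Set.finite_range _).bddBelow (⟨T, hT⟩ : {T // T ∈ P.powersetCard k})
      · rw [key T.1 T.2]
        exact ciInf_le (Set.finite_range _).bddBelow
          (⟨b T.1, Finset.mem_image_of_mem b T.2⟩ : {q // q ∈ (P.powersetCard k).image b})
    rw [heq, sub_self, abs_zero]
    exact hε

end Symmetric

/-! ### Assembly -/

/-- If the zonotope of `a` is close to a ball, every distance-like approximation of the halving
distance of `{± a i}` has many sites. -/
theorem le_of_isApprox {d m n : ℕ} (hd : 2 ≤ d) (hm : 0 < m)
    {a : Fin m → EuclideanSpace ℝ (Fin d)} (ha : ∀ i, ‖a i‖ = 1)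
    (hne : ∀ i j, i ≠ j → a i ≠ a j ∧ a i ≠ -a j) {r : ℝ} (hr : √(2 / Real.pi) ≤ r * √d)
    (hclose : ∀ u : EuclideanSpace ℝ (Fin d), ‖u‖ = 1 →
      |(1 / m) * ∑ i, |⟪a i, u⟫_ℝ| - r| ≤ √(2 / Real.pi) / d / 10)
    (happ : IsApprox (kDist (symmSet a) m) (√(2 / Real.pi) / d) n) :
    2 * √d * ((d : ℝ) / 64) ^ (((d : ℝ) - 1) / 4) ≤ n := by
  obtain ⟨Q, w, hQ, hw, rfl, happ⟩ := happ
  have hd0 : (2 : ℝ) ≤ d := by exact_mod_cast hd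
  have hm0 : (0 : ℝ) < m := by exact_mod_cast hm
  have hy0 : 0 < √(d : ℝ) := Real.sqrt_pos.2 (by linarith)
  have hyy : √(d : ℝ) ^ 2 = d := Real.sq_sqrt (by linarith)
  have hσ : 0 < √(2 / Real.pi) := by positivity
  have hr0 : 0 < r := pos_of_mul_pos_left (hσ.trans_le hr) hy0.le
  set ε := √(2 / Real.pi) / d with hε
  have hε0 : 0 ≤ ε := by positivity
  set η := 11 / (10 * √(d : ℝ)) with hη
  have hη0 : 0 < η := by positivity
  have hη1 : η < 1 := by
    rw [hη, div_lt_one (by positivity)]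
    have : 1.4 ≤ √(d : ℝ) := Real.le_sqrt_of_sq_le (by norm_num; linarith)
    linarith
  -- The total error 11ε/10 is the approximation error ε plus the sampling error ε/10.
  have hrη : 11 / 10 * ε ≤ r * η := by
    have : ε = √(2 / Real.pi) / √d / √d := by rw [hε, div_div, ← sq, hyy]
    rw [this, hη]
    have h1 : √(2 / Real.pi) / √d ≤ r := (div_le_iff₀ hy0).2 hr
    calc 11 / 10 * (√(2 / Real.pi) / √d / √d) ≤ 11 / 10 * (r / √d) := by gcongr
      _ = r * (11 / (10 * √d)) := by field_simp
  have hsupp : ∀ u : EuclideanSpace ℝ (Fin d), ‖u‖ = 1 →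
      (∀ q ∈ Q, ⟪q, u⟫_ℝ ≤ r * (1 + η)) ∧ ∃ q ∈ Q, r * (1 - η) ≤ ⟪q, u⟫_ℝ := by
    intro u hu
    have hA0 : 0 ≤ (1 / m) * ∑ i, |⟪a i, u⟫_ℝ| := by positivity
    have hA1 : (1 / m) * ∑ i, |⟪a i, u⟫_ℝ| ≤ 1 := by
      rw [one_div, inv_mul_le_iff₀ hm0, mul_one]
      refine (Finset.sum_le_card_nsmul _ _ 1 fun i _ => ?_).trans (by simp)
      simpa [ha i, hu] using abs_real_inner_le_norm (a i) u
    obtain ⟨h1, q, hq, h2⟩ := support_close hQ hw hε0 happ hu hA0 hA1 fun t ht => by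
      rw [kDist_symmSet hm ha hne, norm_smul, hu, mul_one, Real.norm_of_nonneg ht]
      simp only [real_inner_smul_right, abs_mul, abs_of_nonneg ht, ← Finset.mul_sum]
      congr 1
      ring
    have h3 := abs_le.1 (hclose u hu)
    exact ⟨fun q hq => by linarith [h1 q hq], q, hq, by linarith⟩
  have : Nontrivial (EuclideanSpace ℝ (Fin d)) :=
    Module.nontrivial_of_finrank_pos (R := ℝ) (by rw [finrank_euclideanSpace_fin]; omega)
  have hcard := one_sub_pow_le_card_mul (Q := Q) (c := (1 - η) / (1 + η)) (R := r * (1 + η))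
    (div_pos (by linarith) (by linarith)) (by positivity) (fun q hq => by
      rcases eq_or_ne q 0 with rfl | hq0
      · rw [norm_zero]
        positivity
      · have hqn : 0 < ‖q‖ := norm_pos_iff.2 hq0
        have h1 := (hsupp (‖q‖⁻¹ • q) (by
          rw [norm_smul, norm_inv, norm_norm, inv_mul_cancel₀ hqn.ne'])).1 q hq
        rwa [real_inner_smul_right, real_inner_self_eq_norm_sq, sq, inv_mul_cancel_left₀ hqn.ne']
          at h1) (fun u hu => by
      obtain ⟨q, hq, h⟩ := (hsupp u hu).2
      refine ⟨q, hq, le_trans (le_of_eq ?_) h⟩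
      field_simp)
  · rw [finrank_euclideanSpace_fin] at hcard
    exact card_lower_bound hd hη rfl hcard

/-- Concentration at the required scale for samples of size at least `3000 * d ^ 2`. -/
theorem exists_symmetric_sample {d m : ℕ} (hd : 2 ≤ d) (hm : 3000 * (d : ℝ) ^ 2 ≤ m) :
    ∃ (a : Fin m → EuclideanSpace ℝ (Fin d)) (r : ℝ), (∀ i, ‖a i‖ = 1) ∧
      (∀ i j, i ≠ j → a i ≠ a j ∧ a i ≠ -a j) ∧ √(2 / Real.pi) ≤ r * √d ∧
      ∀ u : EuclideanSpace ℝ (Fin d), ‖u‖ = 1 →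
        |(1 / m) * ∑ i, |⟪a i, u⟫_ℝ| - r| ≤ √(2 / Real.pi) / d / 10 := by
  have hfin : 2 ≤ Module.finrank ℝ (EuclideanSpace ℝ (Fin d)) := by
    rwa [finrank_euclideanSpace_fin]
  have hd0 : (2 : ℝ) ≤ d := by exact_mod_cast hd
  have hm0 : (0 : ℝ) < m := lt_of_lt_of_le (by positivity) hm
  have := nullSingletonClass_sphereLaw hfin
  obtain ⟨r, hr, hrd⟩ := exists_sphereLaw_const hfin
  rw [finrank_euclideanSpace_fin] at hrd
  obtain ⟨a, ha, hne, hclose⟩ := exists_sample (ae_sphereLaw_norm hfin) hr m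
  refine ⟨a, r, ha, hne, hrd, fun u hu => ?_⟩
  -- 54² ≤ 3000, and 4/54 < 0.079 leaves room for √(2/π) > 0.79.
  have h1 : 54 * (d : ℝ) ≤ √m := Real.le_sqrt_of_sq_le (by nlinarith)
  have hsm : √(m : ℝ) * √m = m := Real.mul_self_sqrt hm0.le
  have hs0 : 0 < √(m : ℝ) := Real.sqrt_pos.2 hm0
  have h2 : 0.79 ≤ √(2 / Real.pi) := by
    refine Real.le_sqrt_of_sq_le ?_
    rw [le_div_iff₀ Real.pi_pos]
    nlinarith [Real.pi_lt_d2]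
  have h3 : (1 / (m : ℝ)) * ∑ i, |⟪a i, u⟫_ℝ| - r =
      (1 / (m : ℝ)) * (∑ i, |⟪a i, u⟫_ℝ| - m * r) := by
    field_simp
  rw [h3, abs_mul, abs_of_nonneg (by positivity)]
  calc 1 / (m : ℝ) * |∑ i, |⟪a i, u⟫_ℝ| - m * r| ≤ 1 / (m : ℝ) * (4 * √m) := by
        gcongr
        exact hclose u hu
    _ = 4 / √m := by
        rw [div_mul_eq_mul_div, one_mul, div_eq_div_iff hm0.ne' hs0.ne', mul_assoc, hsm]
    _ ≤ 4 / (54 * d) := by gcongr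
    _ ≤ 0.79 / d / 10 := by
        rw [div_div, div_le_div_iff₀ (by positivity) (by positivity)]
        linarith
    _ ≤ √(2 / Real.pi) / d / 10 := by gcongr

end HalvingDistance

open HalvingDistance in
theorem mainTheorem4 :
    ∃ C₁ : ℝ, 0 < C₁ ∧
      ∃ S : (d : ℕ) → Finset (EuclideanSpace ℝ (Fin d)),
        ∀ d : ℕ, 2 ≤ d →
          (∀ p ∈ S d, ‖p‖ = 1) ∧
          (S d).card = 2 * ⌈(d : ℝ) ^ 2 * (Real.log (d : ℝ) + C₁) / 2⌉₊ ∧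
          2 * Real.sqrt (d : ℝ) * ((d : ℝ) / 64) ^ (((d : ℝ) - 1) / 4) ≤
            (HalvingDistance.complexity (HalvingDistance.kDist (S d) ((S d).card / 2))
              (Real.sqrt (2 / Real.pi) / (d : ℝ)) : ℝ) := by
  -- After halving, 6000 yields m ≥ 3000 d².
  refine ⟨6000, by norm_num, ?_⟩
  rw [← Classical.skolem (p := fun d (S : Finset (EuclideanSpace ℝ (Fin d))) => 2 ≤ d →
    (∀ p ∈ S, ‖p‖ = 1) ∧ S.card = 2 * ⌈(d : ℝ) ^ 2 * (Real.log (d : ℝ) + 6000) / 2⌉₊ ∧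
      2 * Real.sqrt (d : ℝ) * ((d : ℝ) / 64) ^ (((d : ℝ) - 1) / 4) ≤
        (complexity (kDist S (S.card / 2)) (Real.sqrt (2 / Real.pi) / (d : ℝ)) : ℝ))]
  intro d
  by_cases hd : 2 ≤ d
  swap
  · exact ⟨∅, fun h => absurd h hd⟩
  set m := ⌈(d : ℝ) ^ 2 * (Real.log (d : ℝ) + 6000) / 2⌉₊ with hm
  have hd0 : (2 : ℝ) ≤ d := by exact_mod_cast hd
  have hm1 : 3000 * (d : ℝ) ^ 2 ≤ m := by
    refine le_trans ?_ (Nat.le_ceil _)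
    have := mul_nonneg (sq_nonneg (d : ℝ)) (Real.log_nonneg (by linarith : (1 : ℝ) ≤ d))
    linarith
  have hm0 : 0 < m := by
    have : (0 : ℝ) < m := lt_of_lt_of_le (by positivity) hm1
    exact_mod_cast this
  obtain ⟨a, r, ha, hne, hr, hclose⟩ := exists_symmetric_sample hd hm1
  have hcard := card_symmSet ha hne
  refine ⟨symmSet a, fun _ => ⟨fun p hp => norm_of_mem_symmSet ha hp, hcard, ?_⟩⟩
  rw [hcard, Nat.mul_div_cancel_left m two_pos]
  -- The infimum of an empty set of naturals is 0, so it must be checked that some approximation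
  -- exists.
  have hmem : IsApprox (kDist (symmSet a) m) (√(2 / Real.pi) / d)
      (complexity (kDist (symmSet a) m) (√(2 / Real.pi) / d)) :=
    Nat.sInf_mem (s := {n | IsApprox (kDist (symmSet a) m) (√(2 / Real.pi) / d) n})
      (exists_isApprox_kDist hm0 (fun p hp => norm_of_mem_symmSet ha hp)
        (by rw [hcard]; omega) (by positivity))
  exact le_of_isApprox hd hm0 ha hne hr hclose hmem
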